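/- Let $K$ be an algebraically closed field of characteristic zero and $R=K[x_1,\dots,x_{n+1}]$ the homogeneous coordinate ring of $\mathbb P^n=\mathbb P^n_K$. Let $L$ be the union of $s$ pairwise disjoint linear subspaces of dimension $r\ge 0$ of $\mathbb P^n$, and let $I\subset R$ be the homogeneous ideal of $L$, that is, the ideal generated by all homogeneous polynomials vanishing on $L$. For $m\ge 1$ let $$I^{(m)}=\bigcap_{Q\in\operatorname{Ass}(R/I)}\bigl(I^m R_Q\cap R\bigr)$$ be the $m$-th symbolic power of $I$, and let $\mathrm{HP}_{I^{(m)}}$ be its Hilbert polynomial, i.e. the polynomial with $\mathrm{HP}_{I^{(m)}}(t)=\dim_K\bigl(R_t/(I^{(m)})_t\bigr)$ for all sufficiently large integers $t$. Put $$P_m(t)=\binom{t+n}{n}-\mathrm{HP}_{I^{(m)}}(t)\in\mathbb Q[t].$$ Then: (a) The Hilbert polynomial $\mathrm{HP}_{I^{(m)}}$ exists for every $m\ge 1$. (b) $P_m(mt)$ is a polynomial in $m$ with coefficients in $\mathbb Q[t]$, i.e. there is a (necessarily unique) $F\in\mathbb Q[t][y]$ such that $F(m)=P_m(mt)$ in $\mathbb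 Q[t]$ for all integers $m\ge1$. Let $\Lambda_{n,r,s}(t)\in\mathbb Q[t]$ be the leading coefficient of $F$ with respect to $y$ (taken to be $0$ if $F=0$). It depends, for the given field $K$, only on $n$, $r$ and $s$, and not on the choice of the subspaces. (c) For every real $t$ the limit defining the asymptotic Hilbert polynomial $$\mathrm{aHP}_I(t)=\lim_{m\to\infty}\frac{\mathrm{HP}_{I^{(m)}}(mt)}{m^n}$$ exists, and $$\mathrm{aHP}_I(t)=\frac{t^n}{n!}-\Lambda_{n,r,s}(t).$$ -/

import Mathlib

open Filter Topology Polynomial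
open scoped Nat LinearAlgebra.Projectivization

noncomputable section

/-- The `m`-th symbolic power `I^(m)` of an ideal `I`: the intersection, over all associated primes
`Q` of `R ⧸ I`, of the contractions to `R` of the localized ideals `(I ^ m)_Q`. -/
def symbolicPower {R : Type*} [CommRing R] (I : Ideal R) (m : ℕ) : Ideal R :=
  ⨅ Q : {Q : Ideal R // Q ∈ associatedPrimes R (R ⧸ I)},
    haveI : Q.1.IsPrime := Q.2.isPrime
    Ideal.comap (algebraMap R (Localization.AtPrime Q.1))
      (Ideal.map (algebraMap R (Localization.AtPrime Q.1)) (I ^ m))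

section Projective

variable {K : Type*} [Field K] {n : ℕ}

/-- The homogeneous ideal, in `n + 1` variables, of a set `S` of points of `ℙⁿ`: it is generated by
the homogeneous polynomials vanishing at every point of `S`. -/
def homogeneousVanishingIdeal (S : Set (ℙ K (Fin (n + 1) → K))) :
    Ideal (MvPolynomial (Fin (n + 1)) K) :=
  Ideal.span {f | (∃ d : ℕ, f.IsHomogeneous d) ∧
    ∀ (v : Fin (n + 1) → K) (hv : v ≠ 0), Projectivization.mk K v hv ∈ S →
      MvPolynomial.eval v f = 0}

/-- The Hilbert function `HF_I(t) = dim_K (K[ℙⁿ]_t / I_t)`, with `I_t = I ∩ K[ℙⁿ]_t`. -/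
def hilbertFunction (I : Ideal (MvPolynomial (Fin (n + 1)) K)) (t : ℕ) : ℕ :=
  Module.finrank K
    (MvPolynomial.homogeneousSubmodule (Fin (n + 1)) K t ⧸
      (I.restrictScalars K).comap (MvPolynomial.homogeneousSubmodule (Fin (n + 1)) K t).subtype)

/-- `P` is the Hilbert polynomial of `I`: it agrees with the Hilbert function in all sufficiently
large degrees. There is at most one such `P`. -/
def IsHilbertPolynomial (I : Ideal (MvPolynomial (Fin (n + 1)) K)) (P : ℚ[X]) : Prop :=
  ∀ᶠ t : ℕ in atTop, (hilbertFunction I t : ℚ) = P.eval (t : ℚ)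

open Classical in
/-- The Hilbert polynomial `HP_I` (with value `0` if there is none). -/
def hilbertPolynomial (I : Ideal (MvPolynomial (Fin (n + 1)) K)) : ℚ[X] :=
  if h : ∃ P : ℚ[X], IsHilbertPolynomial I P then h.choose else 0

/-- The value `aHP_I(t) = lim_{m → ∞} HP_{I^(m)}(m t) / m ^ n` of the asymptotic Hilbert polynomial
of `I` at a real number `t`. -/
def asymptoticHilbertPolynomial (I : Ideal (MvPolynomial (Fin (n + 1)) K)) (t : ℝ) : ℝ :=
  limUnder atTop fun m : ℕ =>
    aeval ((m : ℝ) * t) (hilbertPolynomial (symbolicPower I m)) / (m : ℝ) ^ n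

/-- The polynomial `binom(t + n, n) - HP_{I^(m)}(t)` in the variable `t`. -/
def hilbertDefect (I : Ideal (MvPolynomial (Fin (n + 1)) K)) (m : ℕ) : ℚ[X] :=
  C ((n ! : ℚ)⁻¹) * ∏ i ∈ Finset.range n, (X + C ((i : ℚ) + 1))
    - hilbertPolynomial (symbolicPower I m)

/-- `Q` expresses `binom(m t + n, n) - HP_{I^(m)}(m t)` as a polynomial in `m`: the outer variable
of `Q` is `m` and its coefficients are polynomials in `t`. There is at most one such `Q`. -/
def IsDefectPolynomial (I : Ideal (MvPolynomial (Fin (n + 1)) K)) (Q : ℚ[X][X]) : Prop :=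
  ∀ m : ℕ, 1 ≤ m → Q.eval (C (m : ℚ)) = (hilbertDefect I m).comp (C (m : ℚ) * X)

open Classical in
/-- The polynomial `Λ(t)`: the leading coefficient, with respect to `m`, of
`binom(m t + n, n) - HP_{I^(m)}(m t)` (with value `0` if that is not a polynomial in `m`). -/
def leadingDefect (I : Ideal (MvPolynomial (Fin (n + 1)) K)) : ℚ[X] :=
  if h : ∃ Q : ℚ[X][X], IsDefectPolynomial I Q then h.choose.leadingCoeff else 0

/-- `L` is a family of `s` pairwise disjoint linear subspaces of dimension `r` of `ℙⁿ`. -/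
structure IsDisjointFlats (r s : ℕ) (L : Fin s → Projectivization.Subspace K (Fin (n + 1) → K)) :
    Prop where
  finrank_eq : ∀ i, Module.finrank K (L i).submodule = r + 1
  disjoint : Pairwise fun i j => Disjoint (L i : Set (ℙ K (Fin (n + 1) → K))) (L j)

/-- The homogeneous ideal of the union of the linear subspaces `L i` of `ℙⁿ`. -/
def idealOfFlats {s : ℕ} (L : Fin s → Projectivization.Subspace K (Fin (n + 1) → K)) :
    Ideal (MvPolynomial (Fin (n + 1)) K) :=
  homogeneousVanishingIdeal (⋃ i, (L i : Set (ℙ K (Fin (n + 1) → K))))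

end Projective

end

/-! The Hilbert polynomial of `I^(m)` can be written down. `I` is the intersection of the prime
ideals `P_i` of the flats, none containing another, and powers of `P_i` are `P_i`-primary, so `I^(m)
= ⋂ P_i^m` (`symbolicPower_iInf`). The linear forms vanishing on one of two disjoint flats together
span all linear forms; hence `P_i^m + P_j^m` contains a power of the irrelevant ideal, and in large
degrees the Hilbert functions of the `P_i^m` add up (`eventually_hilbertFunction_inf`). In adapted
coordinates `P_i` is generated by `c = n - r` variables, so `R/P_i^m` has as basis the monomials of
degree `< m` in these variables (`hilbertFunction_flatIdeal_pow`). Therefore `HP(t) = s * ∑_{j<m}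
multichoose(c, j) * binom(t - j + r, r)`, which sees only `n`, `r`, `s`.

For `c > 0`, substituting `m t` and summing powers of `j` by Faulhaber gives a polynomial in `m` of
degree at most `n` whose coefficients have degree at most `r` in `t`
(`isPolynomialFamily_flatsHilbertPolynomial`). As `r < n`, the coefficient of `m^n` in the defect
keeps its term `t^n/n!`; it is nonzero, so it is `Λ`, and dividing by `m^n` gives the limit. The
cases `s = 0` and `r = n`, `s = 1` are treated apart. -/

noncomputable section


/-! ### Powers of an ideal generated by variables -/

section Coordinates

variable {K : Type*} [Field K] {α β : Type*}

variable (K α β) in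
/-- The ideal generated by the first group of variables. -/
def inlIdeal : Ideal (MvPolynomial (α ⊕ β) K) :=
  Ideal.span (Set.range fun i : α => MvPolynomial.X (Sum.inl i))

variable (K α β) in
/-- The algebra map multiplying the first group of variables by a new variable. -/
def inlScale : MvPolynomial (α ⊕ β) K →ₐ[K] (MvPolynomial (α ⊕ β) K)[X] :=
  MvPolynomial.aeval (Sum.elim (fun i => C (MvPolynomial.X (Sum.inl i)) * X)
    (fun j => C (MvPolynomial.X (Sum.inr j))))

lemma eval_coeff_zero_inlScale (f : MvPolynomial (α ⊕ β) K) (v : α ⊕ β → K) :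
    MvPolynomial.eval v ((inlScale K α β f).coeff 0) =
      MvPolynomial.eval (Sum.elim 0 fun j => v (Sum.inr j)) f := by
  have : ((MvPolynomial.aeval v : MvPolynomial (α ⊕ β) K →ₐ[K] K).comp
      ((Polynomial.aeval (0 : MvPolynomial (α ⊕ β) K)).restrictScalars K)).comp (inlScale K α β) =
      MvPolynomial.aeval (Sum.elim 0 fun j => v (Sum.inr j)) := by
    ext i
    rcases i with i | j <;> simp [inlScale]
  have h := DFunLike.congr_fun this f
  simpa [Polynomial.coeff_zero_eq_aeval_zero, MvPolynomial.aeval_eq_eval] using h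

variable [Fintype α]

/-- The degree of an exponent in the first group of variables. -/
def inlDegree (d : α ⊕ β →₀ ℕ) : ℕ := ∑ i, d (Sum.inl i)

variable [Fintype β]

lemma inlScale_monomial (d : α ⊕ β →₀ ℕ) (a : K) :
    inlScale K α β (MvPolynomial.monomial d a) =
      C (MvPolynomial.monomial d a) * X ^ inlDegree d := by
  rw [inlScale, MvPolynomial.aeval_monomial, MvPolynomial.monomial_eq,
    Finsupp.prod_fintype _ _ (by simp), Finsupp.prod_fintype _ _ (by simp)]
  simp only [Fintype.prod_sum_type, Sum.elim_inl, Sum.elim_inr, mul_pow, Finset.prod_mul_distrib,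
    map_mul, map_prod, map_pow, inlDegree, Finset.prod_pow_eq_pow_sum]
  rw [IsScalarTower.algebraMap_apply K (MvPolynomial (α ⊕ β) K)]
  simp only [Polynomial.algebraMap_eq, MvPolynomial.algebraMap_eq]
  ring

lemma coeff_coeff_inlScale (f : MvPolynomial (α ⊕ β) K) (k : ℕ) (d : α ⊕ β →₀ ℕ) :
    MvPolynomial.coeff d ((inlScale K α β f).coeff k) =
      if inlDegree d = k then MvPolynomial.coeff d f else 0 := by
  classical
  induction f using MvPolynomial.induction_on' with
  | monomial u a =>
    rw [inlScale_monomial, Polynomial.coeff_C_mul_X_pow]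
    simp only [MvPolynomial.coeff_monomial]
    by_cases h : u = d
    · subst h; simp only [eq_comm (a := k)]; split_ifs <;> simp
    · split_ifs <;> simp [h]
  | add p q hp hq =>
    rw [map_add, Polynomial.coeff_add, MvPolynomial.coeff_add, hp, hq, MvPolynomial.coeff_add]
    split_ifs <;> simp

lemma X_pow_dvd_inlScale_iff (f : MvPolynomial (α ⊕ β) K) (m : ℕ) :
    X ^ m ∣ inlScale K α β f ↔ ∀ d ∈ f.support, m ≤ inlDegree d := by
  rw [Polynomial.X_pow_dvd_iff]
  constructor
  · intro h d hd
    by_contra! hlt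
    have := congrArg (MvPolynomial.coeff d) (h _ hlt)
    rw [coeff_coeff_inlScale, if_pos rfl] at this
    exact (MvPolynomial.mem_support_iff.1 hd) (by simpa using this)
  · intro h k hk
    ext d
    rw [coeff_coeff_inlScale, MvPolynomial.coeff_zero]
    split_ifs with hd
    · by_contra hne
      have := h d (MvPolynomial.mem_support_iff.2 hne)
      omega
    · rfl

/-- Both sides say that every monomial of `f` has degree at least `m` in the first variables.
Divisibility by a power of the prime element `X` later yields primality and primaryness at once. -/
lemma mem_inlIdeal_pow_iff (f : MvPolynomial (α ⊕ β) K) (m : ℕ) :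
    f ∈ inlIdeal K α β ^ m ↔ X ^ m ∣ inlScale K α β f := by
  constructor
  · intro hf
    have h1 : inlIdeal K α β ≤
        Ideal.comap (inlScale K α β) (Ideal.span {(X : (MvPolynomial (α ⊕ β) K)[X])}) := by
      rw [inlIdeal, Ideal.span_le]
      rintro _ ⟨i, rfl⟩
      simp only [SetLike.mem_coe, Ideal.mem_comap, Ideal.mem_span_singleton]
      simp [inlScale]
    have h2 := Ideal.le_comap_pow (inlScale K α β) m (Ideal.pow_right_mono h1 m hf)
    rwa [Ideal.mem_comap, Ideal.span_singleton_pow, Ideal.mem_span_singleton] at h2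
  · rw [X_pow_dvd_inlScale_iff]
    intro h
    rw [f.as_sum]
    refine Ideal.sum_mem _ fun d hd => ?_
    rw [MvPolynomial.monomial_eq, Finsupp.prod_fintype _ _ (by simp), Fintype.prod_sum_type]
    refine Ideal.mul_mem_left _ _ (Ideal.mul_mem_right _ _ (Ideal.pow_le_pow_right (h d hd) ?_))
    rw [inlDegree, ← Finset.prod_pow_eq_pow_sum]
    exact Ideal.prod_mem_prod fun i _ =>
      Ideal.pow_mem_pow (Ideal.subset_span (Set.mem_range_self i)) _

lemma mem_inlIdeal_iff_eval [Infinite K] (f : MvPolynomial (α ⊕ β) K) :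
    f ∈ inlIdeal K α β ↔
      ∀ v : α ⊕ β → K, (∀ i, v (Sum.inl i) = 0) → MvPolynomial.eval v f = 0 := by
  rw [← pow_one (inlIdeal K α β), mem_inlIdeal_pow_iff, pow_one, Polynomial.X_dvd_iff]
  constructor
  · intro h v hv
    have := eval_coeff_zero_inlScale f v
    rw [h, map_zero] at this
    rw [this]
    congr 1
    congr 1
    ext i
    rcases i with i | j <;> simp [hv]
  · intro h
    refine MvPolynomial.funext fun v => ?_
    rw [eval_coeff_zero_inlScale, map_zero]
    exact h _ (by simp)

end Coordinates


/-! ### The prime ideal of a linear subspace -/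

section Flats

variable {K : Type*} [Field K] {n : ℕ}

/-- The ideal of all polynomials vanishing on a linear subspace. -/
def flatIdeal (W : Submodule K (Fin (n + 1) → K)) : Ideal (MvPolynomial (Fin (n + 1)) K) :=
  MvPolynomial.vanishingIdeal K (W : Set (Fin (n + 1) → K))

lemma mem_flatIdeal {W : Submodule K (Fin (n + 1) → K)} {f : MvPolynomial (Fin (n + 1)) K} :
    f ∈ flatIdeal W ↔ ∀ v ∈ W, MvPolynomial.eval v f = 0 := by
  simp [flatIdeal, MvPolynomial.mem_vanishingIdeal_iff, MvPolynomial.aeval_eq_eval]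

section Substitution

variable {σ : Type*} [Fintype σ] [DecidableEq σ]

/-- The linear change of coordinates given by a basis. -/
def basisAlgEquiv (b : Module.Basis σ K (Fin (n + 1) → K)) :
    MvPolynomial (Fin (n + 1)) K ≃ₐ[K] MvPolynomial σ K :=
  AlgEquiv.ofAlgHom
    (MvPolynomial.bind₁ ((Pi.basisFun K (Fin (n + 1))).toMatrix b).toMvPolynomial)
    (MvPolynomial.bind₁ (b.toMatrix (Pi.basisFun K (Fin (n + 1)))).toMvPolynomial)
    (by
      ext i
      simp [← Matrix.toMvPolynomial_mul])
    (by
      ext i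
      simp [← Matrix.toMvPolynomial_mul])

lemma eval_basisAlgEquiv (b : Module.Basis σ K (Fin (n + 1) → K)) (w : σ → K)
    (f : MvPolynomial (Fin (n + 1)) K) :
    MvPolynomial.eval w (basisAlgEquiv b f) = MvPolynomial.eval (∑ i, w i • b i) f := by
  have : (MvPolynomial.aeval w).comp (basisAlgEquiv b).toAlgHom =
      (MvPolynomial.aeval (∑ i, w i • b i) : MvPolynomial (Fin (n + 1)) K →ₐ[K] K) := by
    ext i
    simp [basisAlgEquiv, MvPolynomial.aeval_eq_eval, Matrix.toMvPolynomial_eval_eq_apply,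
      Matrix.mulVec, dotProduct, Module.Basis.toMatrix_apply, mul_comm]
  simpa [MvPolynomial.aeval_eq_eval] using DFunLike.congr_fun this f

lemma isHomogeneous_basisAlgEquiv (b : Module.Basis σ K (Fin (n + 1) → K)) {t : ℕ}
    {f : MvPolynomial (Fin (n + 1)) K} (hf : f.IsHomogeneous t) :
    (basisAlgEquiv b f).IsHomogeneous t := by
  have := hf.aeval _ fun i =>
    Matrix.toMvPolynomial_isHomogeneous ((Pi.basisFun K (Fin (n + 1))).toMatrix b) i
  rwa [one_mul] at this

lemma isHomogeneous_basisAlgEquiv_symm (b : Module.Basis σ K (Fin (n + 1) → K)) {t : ℕ}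
    {f : MvPolynomial σ K} (hf : f.IsHomogeneous t) :
    ((basisAlgEquiv b).symm f).IsHomogeneous t := by
  have := hf.aeval _ fun i =>
    Matrix.toMvPolynomial_isHomogeneous (b.toMatrix (Pi.basisFun K (Fin (n + 1)))) i
  rwa [one_mul] at this

end Substitution

lemma exists_basis_adapted {c r : ℕ} (W : Submodule K (Fin (n + 1) → K))
    (hW : Module.finrank K W = r + 1) (hc : c + r = n) :
    ∃ b : Module.Basis (Fin c ⊕ Fin (r + 1)) K (Fin (n + 1) → K),
      ∀ v, v ∈ W ↔ ∀ i, b.repr v (Sum.inl i) = 0 := by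
  obtain ⟨U, hU⟩ := W.exists_isCompl
  have hfin : Module.finrank K U = c := by
    have := Submodule.finrank_add_eq_of_isCompl hU
    rw [Module.finrank_fin_fun] at this
    omega
  let bU := Module.finBasisOfFinrankEq K U hfin
  let bW := Module.finBasisOfFinrankEq K W hW
  refine ⟨(bU.prod bW).map (Submodule.prodEquivOfIsCompl U W hU.symm), fun v => ?_⟩
  rw [← Submodule.prodEquivOfIsCompl_symm_apply_fst_eq_zero _ _ hU.symm,
    ← bU.repr.map_eq_zero_iff, Finsupp.ext_iff]
  simp

lemma mem_flatIdeal_iff_inlIdeal [Infinite K] {α β : Type*} [Fintype α] [Fintype β]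
    [DecidableEq α] [DecidableEq β]
    {W : Submodule K (Fin (n + 1) → K)} {b : Module.Basis (α ⊕ β) K (Fin (n + 1) → K)}
    (hb : ∀ v, v ∈ W ↔ ∀ i, b.repr v (Sum.inl i) = 0) (f : MvPolynomial (Fin (n + 1)) K) :
    f ∈ flatIdeal W ↔ basisAlgEquiv b f ∈ inlIdeal K α β := by
  rw [mem_flatIdeal, mem_inlIdeal_iff_eval]
  simp_rw [eval_basisAlgEquiv]
  constructor
  · intro h w hw
    refine h _ ((hb _).2 fun i => ?_)
    rw [b.repr_sum_self, hw]
  · intro h v hv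
    have := h (b.repr v) ((hb v).1 hv)
    rwa [b.sum_repr] at this

lemma mem_flatIdeal_pow_iff [Infinite K] {α β : Type*} [Fintype α] [Fintype β]
    [DecidableEq α] [DecidableEq β]
    {W : Submodule K (Fin (n + 1) → K)} {b : Module.Basis (α ⊕ β) K (Fin (n + 1) → K)}
    (hb : ∀ v, v ∈ W ↔ ∀ i, b.repr v (Sum.inl i) = 0) (f : MvPolynomial (Fin (n + 1)) K) (m : ℕ) :
    f ∈ flatIdeal W ^ m ↔ X ^ m ∣ inlScale K α β (basisAlgEquiv b f) := by
  have h : Ideal.map (basisAlgEquiv b) (flatIdeal W) = inlIdeal K α β := by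
    ext g
    rw [Ideal.mem_map_of_equiv]
    constructor
    · rintro ⟨f, hf, rfl⟩
      exact (mem_flatIdeal_iff_inlIdeal hb f).1 hf
    · intro hg
      exact ⟨(basisAlgEquiv b).symm g, (mem_flatIdeal_iff_inlIdeal hb _).2 (by simpa using hg),
        by simp⟩
  rw [← mem_inlIdeal_pow_iff, ← h, ← Ideal.map_pow, Ideal.mem_map_of_equiv]
  constructor
  · exact fun hf => ⟨f, hf, rfl⟩
  · rintro ⟨g, hg, hgf⟩
    rwa [← (basisAlgEquiv b).injective hgf]

lemma flatIdeal_isPrime [Infinite K] {c r : ℕ} (hc : c + r = n)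
    {W : Submodule K (Fin (n + 1) → K)} (hW : Module.finrank K W = r + 1) :
    (flatIdeal W).IsPrime := by
  obtain ⟨b, hb⟩ := exists_basis_adapted W hW hc
  have hone := fun f => mem_flatIdeal_pow_iff hb f 1
  simp only [pow_one] at hone
  refine ⟨?_, ?_⟩
  · rw [Ideal.ne_top_iff_one, mem_flatIdeal]
    intro h
    simpa using h 0 W.zero_mem
  · intro x y
    rw [hone, hone, hone, map_mul, map_mul]
    exact Polynomial.prime_X.dvd_or_dvd

/-- Powers of the ideal of a flat are primary: if the prime `X` does not divide a factor, all of `X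
^ m` must divide the other one. -/
lemma mem_flatIdeal_pow_of_mul_mem [Infinite K] {c r : ℕ} (hc : c + r = n)
    {W : Submodule K (Fin (n + 1) → K)} (hW : Module.finrank K W = r + 1) {m : ℕ}
    {u f : MvPolynomial (Fin (n + 1)) K} (hu : u ∉ flatIdeal W) (hf : u * f ∈ flatIdeal W ^ m) :
    f ∈ flatIdeal W ^ m := by
  obtain ⟨b, hb⟩ := exists_basis_adapted W hW hc
  rw [mem_flatIdeal_pow_iff hb, map_mul, map_mul] at hf
  rw [mem_flatIdeal_pow_iff hb]
  rw [← pow_one (flatIdeal W), mem_flatIdeal_pow_iff hb, pow_one] at hu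
  exact Polynomial.prime_X.pow_dvd_of_dvd_mul_left _ hu hf

end Flats


/-! ### Symbolic powers of an intersection of incomparable primes -/

section SymbolicPower

variable {R : Type*} [CommRing R] {ι : Type*} {P : ι → Ideal R}

/-- The annihilator of the class of `x` only feels the primes that miss `x`; an intersection of
primes is already radical. -/
lemma radical_colon_iInf (hP : ∀ i, (P i).IsPrime) (x : R) :
    ((⊥ : Submodule R (R ⧸ ⨅ i, P i)).colon {Ideal.Quotient.mk (⨅ i, P i) x}).radical =
      ⨅ i : {i // x ∉ P i}, P i := by
  have hcolon : (⊥ : Submodule R (R ⧸ ⨅ i, P i)).colon {Ideal.Quotient.mk (⨅ i, P i) x} =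
      ⨅ i : {i // x ∉ P i}, P i := by
    ext a
    rw [Submodule.mem_colon_singleton, Submodule.mem_bot, ← Ideal.Quotient.mk_eq_mk,
      ← Submodule.Quotient.mk_smul, Ideal.Quotient.mk_eq_mk, Ideal.Quotient.eq_zero_iff_mem,
      smul_eq_mul, Ideal.mem_iInf, Ideal.mem_iInf]
    constructor
    · rintro h ⟨i, hi⟩
      exact ((hP i).mem_or_mem (h i)).resolve_right hi
    · intro h i
      by_cases hi : x ∈ P i
      · exact Ideal.mul_mem_left _ _ hi
      · exact Ideal.mul_mem_right _ _ (h ⟨i, hi⟩)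
  rw [hcolon]
  exact (Ideal.isRadical_iInf (fun i : {i // x ∉ P i} => P i) fun i => (hP i).isRadical).radical

variable [Finite ι]

lemma exists_mem_iInf_ne_notMem (hP : ∀ i, (P i).IsPrime) (hne : Pairwise fun i j => ¬ P i ≤ P j)
    (i : ι) : ∃ x ∉ P i, ∀ j ≠ i, x ∈ P j := by
  classical
  have := Fintype.ofFinite ι
  have h : ¬ (Finset.univ.erase i).inf P ≤ P i := by
    rw [(hP i).inf_le']
    rintro ⟨j, hj, hle⟩
    exact hne (Finset.ne_of_mem_erase hj) hle
  obtain ⟨x, hx, hxi⟩ := SetLike.not_le_iff_exists.1 h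
  refine ⟨x, hxi, fun j hj => ?_⟩
  exact (Finset.inf_le (f := P) (Finset.mem_erase.2 ⟨hj, Finset.mem_univ j⟩)) hx

lemma associatedPrimes_quotient_iInf (hP : ∀ i, (P i).IsPrime)
    (hne : Pairwise fun i j => ¬ P i ≤ P j) :
    associatedPrimes R (R ⧸ ⨅ i, P i) = Set.range P := by
  ext Q
  constructor
  · rintro ⟨hQ, x, hx⟩
    obtain ⟨x, rfl⟩ := Ideal.Quotient.mk_surjective x
    rw [radical_colon_iInf hP] at hx
    have := Fintype.ofFinite {i // x ∉ P i}
    have hle : (Finset.univ : Finset {i // x ∉ P i}).inf (fun i => P i) ≤ Q := by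
      rw [Finset.inf_univ_eq_iInf, hx]
    obtain ⟨i, -, hi⟩ := hQ.inf_le'.1 hle
    exact ⟨i, le_antisymm hi (hx.trans_le (iInf_le _ i))⟩
  · rintro ⟨i, rfl⟩
    obtain ⟨x, hxi, hx⟩ := exists_mem_iInf_ne_notMem hP hne i
    refine ⟨hP i, Ideal.Quotient.mk _ x, ?_⟩
    rw [radical_colon_iInf hP]
    refine le_antisymm (le_iInf fun j => ?_) (iInf_le _ (⟨i, hxi⟩ : {i // x ∉ P i}))
    have : (j : ι) = i := by
      by_contra h
      exact j.2 (hx _ h)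
    rw [this]

/-- The associated primes are exactly the `P i`. Localizing at `P i` makes the other primes trivial,
and contracting back adds nothing to `P i ^ m` because it is primary. -/
theorem symbolicPower_iInf (hP : ∀ i, (P i).IsPrime) (hne : Pairwise fun i j => ¬ P i ≤ P j)
    {m : ℕ} (hprim : ∀ i u f, u ∉ P i → u * f ∈ P i ^ m → f ∈ P i ^ m) :
    symbolicPower (⨅ i, P i) m = ⨅ i, P i ^ m := by
  have key : ∀ i, Ideal.comap (algebraMap R (Localization.AtPrime (P i)))
      (Ideal.map (algebraMap R (Localization.AtPrime (P i))) ((⨅ i, P i) ^ m)) = P i ^ m := by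
    intro i
    ext f
    rw [Ideal.mem_comap, IsLocalization.algebraMap_mem_map_algebraMap_iff (P i).primeCompl]
    constructor
    · rintro ⟨u, hu, huf⟩
      exact hprim i u f hu (Ideal.pow_right_mono (iInf_le _ i) m huf)
    · intro hf
      obtain ⟨x, hxi, hx⟩ := exists_mem_iInf_ne_notMem hP hne i
      -- Since `x` lies in every other prime, `x * P i` is inside the intersection, so `x ^ m`
      -- carries `P i ^ m` into its `m`-th power.
      refine ⟨x ^ m, (P i).primeCompl.pow_mem hxi m, ?_⟩
      have hle : Ideal.span {x} * P i ≤ ⨅ i, P i := by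
        refine le_iInf fun j => ?_
        by_cases h : j = i
        · rw [h]; exact Ideal.mul_le_right
        · exact Ideal.mul_le_left.trans ((Ideal.span_singleton_le_iff_mem _).2 (hx j h))
      refine Ideal.pow_right_mono hle m ?_
      rw [mul_pow, Ideal.span_singleton_pow]
      exact Ideal.mul_mem_mul (Ideal.mem_span_singleton_self _) hf
  have hass := associatedPrimes_quotient_iInf hP hne
  refine le_antisymm (le_iInf fun i => ?_) (le_iInf ?_)
  · rw [← key i]
    exact iInf_le_of_le ⟨P i, hass ▸ Set.mem_range_self i⟩ le_rfl
  · rintro ⟨Q, hQ⟩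
    obtain ⟨i, rfl⟩ := hass ▸ hQ
    exact (iInf_le _ i).trans (key i).ge

end SymbolicPower


/-! ### Homogeneity and sums of ideals of flats -/

section FlatGeometry

variable {K : Type*} [Field K] {n : ℕ}

lemma MvPolynomial.IsHomogeneous.eval_smul {σ R : Type*} [Fintype σ] [CommRing R]
    {f : MvPolynomial σ R} {d : ℕ} (hf : f.IsHomogeneous d) (c : R) (v : σ → R) :
    MvPolynomial.eval (c • v) f = c ^ d * MvPolynomial.eval v f := by
  rw [MvPolynomial.eval_eq', MvPolynomial.eval_eq', Finset.mul_sum]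
  refine Finset.sum_congr rfl fun e he => ?_
  have hd : ∑ i, e i = d := by
    rw [← Finsupp.degree_eq_sum, Finsupp.degree_eq_weight_one]
    exact hf (MvPolynomial.mem_support_iff.1 he)
  have h : ∀ i, (c • v) i ^ e i = c ^ e i * v i ^ e i := fun i => mul_pow c (v i) (e i)
  rw [Finset.prod_congr rfl fun i _ => h i, Finset.prod_mul_distrib,
    Finset.prod_pow_eq_pow_sum, hd]
  ring

lemma eval_smul_eq_sum_homogeneousComponent (f : MvPolynomial (Fin (n + 1)) K) (c : K)
    (v : Fin (n + 1) → K) :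
    MvPolynomial.eval (c • v) f =
      (∑ d ∈ Finset.range (f.totalDegree + 1),
        C (MvPolynomial.eval v (MvPolynomial.homogeneousComponent d f)) * X ^ d :
          K[X]).eval c := by
  conv_lhs => rw [← MvPolynomial.sum_homogeneousComponent f]
  rw [map_sum, Polynomial.eval_finsetSum]
  refine Finset.sum_congr rfl fun d _ => ?_
  rw [(MvPolynomial.homogeneousComponent_isHomogeneous d f).eval_smul,
    Polynomial.eval_mul, Polynomial.eval_C, Polynomial.eval_pow, Polynomial.eval_X, mul_comm]

/-- On the line through `v`, `f` restricts to a polynomial in the scalar `c` whose coefficients are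
the values at `v` of its components; vanishing for all `c` in an infinite field kills each one. -/
lemma homogeneousComponent_mem_flatIdeal [Infinite K] {W : Submodule K (Fin (n + 1) → K)}
    {f : MvPolynomial (Fin (n + 1)) K} (hf : f ∈ flatIdeal W) (d : ℕ) :
    MvPolynomial.homogeneousComponent d f ∈ flatIdeal W := by
  rw [mem_flatIdeal] at hf ⊢
  intro v hv
  by_cases hd : d < f.totalDegree + 1
  · have h0 : (∑ d ∈ Finset.range (f.totalDegree + 1),
        C (MvPolynomial.eval v (MvPolynomial.homogeneousComponent d f)) * X ^ d : K[X]) = 0 := by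
      refine Polynomial.funext fun c => ?_
      rw [← eval_smul_eq_sum_homogeneousComponent, Polynomial.eval_zero]
      exact hf _ (W.smul_mem c hv)
    have h1 := congrArg (fun p => Polynomial.coeff p d) h0
    simpa [Polynomial.finsetSum_coeff, Polynomial.coeff_C_mul, Polynomial.coeff_X_pow, hd]
      using h1
  · rw [MvPolynomial.homogeneousComponent_eq_zero _ _ (by omega), map_zero]

attribute [local instance] MvPolynomial.gradedAlgebra

lemma flatIdeal_isHomogeneous [Infinite K] (W : Submodule K (Fin (n + 1) → K)) :
    (flatIdeal W).IsHomogeneous (MvPolynomial.homogeneousSubmodule (Fin (n + 1)) K) := by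
  intro d f hf
  have h := homogeneousComponent_mem_flatIdeal hf d
  rwa [← MvPolynomial.decomposition.decompose'_apply] at h

lemma idealOfFlats_eq_iInf [Infinite K] {s : ℕ}
    (L : Fin s → Projectivization.Subspace K (Fin (n + 1) → K))
    (hL : ∀ i, (L i).submodule ≠ ⊥) :
    idealOfFlats L = ⨅ i, flatIdeal (L i).submodule := by
  refine le_antisymm ?_ fun f hf => ?_
  · rw [idealOfFlats, homogeneousVanishingIdeal, Ideal.span_le]
    rintro f ⟨⟨d, hd⟩, hf⟩
    rw [SetLike.mem_coe, Ideal.mem_iInf]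
    intro i
    rw [mem_flatIdeal]
    have hne : ∀ v ∈ (L i).submodule, v ≠ 0 → MvPolynomial.eval v f = 0 := fun v hv hv0 =>
      hf v hv0 (Set.mem_iUnion.2 ⟨i, (Projectivization.Subspace.mem_submodule_iff _ hv0).1 hv⟩)
    intro v hv
    -- Projective points say nothing about the origin. There a form of positive degree vanishes
    -- anyway, while a constant takes the value it has at a nonzero vector of the subspace.
    by_cases hv0 : v = 0
    · obtain ⟨w, hw, hw0⟩ := Submodule.exists_mem_ne_zero_of_ne_bot (hL i)
      rcases Nat.eq_zero_or_pos d with rfl | hd0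
      · have h1 := hd.eval_smul 0 w
        rw [zero_smul, pow_zero] at h1
        rw [hv0, h1, hne w hw hw0]
        simp
      · have h1 := hd.eval_smul 0 w
        rw [zero_smul, zero_pow hd0.ne'] at h1
        rw [hv0, h1]
        simp
    · exact hne v hv hv0
  · rw [← MvPolynomial.sum_homogeneousComponent f]
    refine Ideal.sum_mem _ fun d _ => Ideal.subset_span
      ⟨⟨d, MvPolynomial.homogeneousComponent_isHomogeneous d f⟩, fun v hv hvL => ?_⟩
    obtain ⟨i, hi⟩ := Set.mem_iUnion.1 hvL
    exact mem_flatIdeal.1 (homogeneousComponent_mem_flatIdeal ((Ideal.mem_iInf).1 hf i) d) v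
      ((Projectivization.Subspace.mem_submodule_iff _ hv).2 hi)

variable (K n) in
/-- The irrelevant ideal of the polynomial ring. -/
abbrev irrelevantIdeal : Ideal (MvPolynomial (Fin (n + 1)) K) :=
  MvPolynomial.idealOfVars (Fin (n + 1)) K

/-- The linear form attached to a functional. -/
def linearFormOfDual (g : Module.Dual K (Fin (n + 1) → K)) : MvPolynomial (Fin (n + 1)) K :=
  ∑ k, MvPolynomial.C (g (Pi.single k 1)) * MvPolynomial.X k

lemma eval_linearFormOfDual (g : Module.Dual K (Fin (n + 1) → K)) (v : Fin (n + 1) → K) :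
    MvPolynomial.eval v (linearFormOfDual g) = g v := by
  conv_rhs => rw [← (Pi.basisFun K (Fin (n + 1))).sum_repr v]
  simp [linearFormOfDual, mul_comm]

/-- The annihilators of two disjoint subspaces span the dual space, so each coordinate is a sum of
linear forms vanishing on `W` and on `W'`. -/
lemma irrelevantIdeal_le_sup [Infinite K] {W W' : Submodule K (Fin (n + 1) → K)}
    (h : Disjoint W W') : irrelevantIdeal K n ≤ flatIdeal W ⊔ flatIdeal W' := by
  refine Ideal.span_le.2 ?_
  rintro _ ⟨k, rfl⟩
  have hmem : (LinearMap.proj k : Module.Dual K (Fin (n + 1) → K)) ∈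
      W.dualAnnihilator ⊔ W'.dualAnnihilator := by
    rw [← Subspace.dualAnnihilator_inf_eq, h.eq_bot, Submodule.dualAnnihilator_bot]
    exact Submodule.mem_top
  obtain ⟨g, hg, g', hg', hsum⟩ := Submodule.mem_sup.1 hmem
  have hX : MvPolynomial.X k = linearFormOfDual g + linearFormOfDual g' := by
    refine MvPolynomial.funext fun v => ?_
    rw [map_add, eval_linearFormOfDual, eval_linearFormOfDual, ← LinearMap.add_apply, hsum]
    simp
  rw [SetLike.mem_coe, hX]
  refine Submodule.add_mem_sup (mem_flatIdeal.2 fun v hv => ?_) (mem_flatIdeal.2 fun v hv => ?_)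
  · rw [eval_linearFormOfDual]
    exact (Submodule.mem_dualAnnihilator _).1 hg v hv
  · rw [eval_linearFormOfDual]
    exact (Submodule.mem_dualAnnihilator _).1 hg' v hv

lemma flatIdeal_le_iff [Infinite K] {W W' : Submodule K (Fin (n + 1) → K)} :
    flatIdeal W ≤ flatIdeal W' ↔ W' ≤ W := by
  refine ⟨fun h v hv => ?_, fun h f hf => ?_⟩
  · by_contra hvW
    obtain ⟨g, hg, hgW⟩ := Submodule.exists_le_ker_of_notMem hvW
    have h1 : linearFormOfDual g ∈ flatIdeal W := mem_flatIdeal.2 fun w hw => by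
      rw [eval_linearFormOfDual]
      exact hgW hw
    have h2 := mem_flatIdeal.1 (h h1) v hv
    rw [eval_linearFormOfDual] at h2
    exact hg h2
  · exact mem_flatIdeal.2 fun v hv => mem_flatIdeal.1 hf v (h hv)

end FlatGeometry


/-! ### Additivity of Hilbert functions in large degree -/

section HilbertFunction

variable {K : Type*} [Field K] {n : ℕ}

attribute [local instance] MvPolynomial.gradedAlgebra

/-- In degree `t ≥ N` the pieces of `I` and `J` span all forms, so the dimension formula for sum and
intersection gives additivity of codimensions. -/
lemma hilbertFunction_inf {I J : Ideal (MvPolynomial (Fin (n + 1)) K)}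
    (hI : I.IsHomogeneous (MvPolynomial.homogeneousSubmodule (Fin (n + 1)) K))
    (hJ : J.IsHomogeneous (MvPolynomial.homogeneousSubmodule (Fin (n + 1)) K))
    {N t : ℕ} (hN : irrelevantIdeal K n ^ N ≤ I ⊔ J) (ht : N ≤ t) :
    hilbertFunction (I ⊓ J) t = hilbertFunction I t + hilbertFunction J t := by
  have : Module.Finite K (MvPolynomial.homogeneousSubmodule (Fin (n + 1)) K t) :=
    Module.Finite.iff_fg.2 (MvPolynomial.homogeneousSubmodule_fg _ _ t)
  set V := MvPolynomial.homogeneousSubmodule (Fin (n + 1)) K t with hV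
  set A := (I.restrictScalars K).comap V.subtype with hA
  set B := (J.restrictScalars K).comap V.subtype with hB
  have hinf : ((I ⊓ J).restrictScalars K).comap V.subtype = A ⊓ B := rfl
  have hsup : A ⊔ B = ⊤ := by
    rw [eq_top_iff]
    rintro ⟨f, hf⟩ -
    have hfN : f ∈ irrelevantIdeal K n ^ N := by
      rw [MvPolynomial.mem_pow_idealOfVars_iff']
      intro d hd
      by_contra hne
      have : d.degree = t := by
        rw [Finsupp.degree_eq_weight_one]
        exact hf hne
      omega
    obtain ⟨a, ha, b, hb, hab⟩ := Submodule.mem_sup.1 (hN hfN)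
    -- The summands `a` and `b` need not be forms; their degree `t` components stay in the
    -- homogeneous ideals and still add up to `f`.
    have ha' := MvPolynomial.homogeneousComponent_mem_of_mem hI ha t
    have hb' := MvPolynomial.homogeneousComponent_mem_of_mem hJ hb t
    refine Submodule.mem_sup.2 ⟨⟨_, MvPolynomial.homogeneousComponent_isHomogeneous t a⟩, ha',
      ⟨_, MvPolynomial.homogeneousComponent_isHomogeneous t b⟩, hb', Subtype.ext ?_⟩
    change MvPolynomial.homogeneousComponent t a + MvPolynomial.homogeneousComponent t b = f
    rw [← map_add, hab, MvPolynomial.homogeneousComponent_of_mem hf, if_pos rfl]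
  have h1 := Submodule.finrank_sup_add_finrank_inf_eq A B
  rw [hsup, finrank_top] at h1
  have h2 := A.finrank_quotient_add_finrank
  have h3 := B.finrank_quotient_add_finrank
  have h4 := (A ⊓ B).finrank_quotient_add_finrank
  have e1 : hilbertFunction (I ⊓ J) t = Module.finrank K (V ⧸ A ⊓ B) := rfl
  have e2 : hilbertFunction I t = Module.finrank K (V ⧸ A) := rfl
  have e3 : hilbertFunction J t = Module.finrank K (V ⧸ B) := rfl
  omega

lemma hilbertFunction_top (t : ℕ) :
    hilbertFunction (⊤ : Ideal (MvPolynomial (Fin (n + 1)) K)) t = 0 := by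
  have : Subsingleton (MvPolynomial.homogeneousSubmodule (Fin (n + 1)) K t ⧸
      ((⊤ : Ideal (MvPolynomial (Fin (n + 1)) K)).restrictScalars K).comap
        (MvPolynomial.homogeneousSubmodule (Fin (n + 1)) K t).subtype) := by
    rw [Submodule.Quotient.subsingleton_iff]
    rfl
  exact Module.finrank_zero_of_subsingleton

/-- Expanding `(A i + C) * (S.inf A + C)`, every product lies in `C` or in the intersection, so the
exponents just add. -/
lemma exists_pow_le_inf_sup {R ι : Type*} [CommRing R] {M C : Ideal R} (A : ι → Ideal R)
    (S : Finset ι) (h : ∀ i ∈ S, ∃ N, M ^ N ≤ A i ⊔ C) : ∃ N, M ^ N ≤ S.inf A ⊔ C := by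
  classical
  induction S using Finset.induction_on with
  | empty => exact ⟨0, by simp⟩
  | insert i S hi ih =>
    obtain ⟨a, ha⟩ := h i (Finset.mem_insert_self _ _)
    obtain ⟨b, hb⟩ := ih fun j hj => h j (Finset.mem_insert_of_mem hj)
    refine ⟨a + b, ?_⟩
    rw [pow_add, Finset.inf_insert]
    refine (Ideal.mul_mono ha hb).trans ?_
    rw [Ideal.sup_mul, Ideal.mul_sup]
    refine sup_le (sup_le ?_ ?_) ?_
    · exact Ideal.mul_le_inf.trans le_sup_left
    · exact (Ideal.mul_le_right (I := A i) (J := C)).trans le_sup_right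
    · exact (Ideal.mul_le_left (I := C)).trans le_sup_right

lemma Ideal.IsHomogeneous.pow_of_homogeneous {I : Ideal (MvPolynomial (Fin (n + 1)) K)}
    (hI : I.IsHomogeneous (MvPolynomial.homogeneousSubmodule (Fin (n + 1)) K)) (m : ℕ) :
    (I ^ m).IsHomogeneous (MvPolynomial.homogeneousSubmodule (Fin (n + 1)) K) := by
  induction m with
  | zero => rw [pow_zero, Ideal.one_eq_top]; exact Ideal.IsHomogeneous.top _
  | succ m ih => rw [pow_succ]; exact ih.mul hI

lemma eventually_hilbertFunction_inf {ι : Type*} (A : ι → Ideal (MvPolynomial (Fin (n + 1)) K))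
    (hA : ∀ i, (A i).IsHomogeneous (MvPolynomial.homogeneousSubmodule (Fin (n + 1)) K))
    (hcop : Pairwise fun i j => ∃ N, irrelevantIdeal K n ^ N ≤ A i ⊔ A j) (S : Finset ι) :
    ∀ᶠ t in atTop, hilbertFunction (S.inf A) t = ∑ i ∈ S, hilbertFunction (A i) t := by
  classical
  induction S using Finset.induction_on with
  | empty => exact Eventually.of_forall fun t => by simpa using hilbertFunction_top t
  | insert i S hi ih =>
    obtain ⟨N, hN⟩ := exists_pow_le_inf_sup (C := A i) A S fun j hj =>
      hcop (ne_of_mem_of_not_mem hj hi)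
    have hS : (S.inf A).IsHomogeneous (MvPolynomial.homogeneousSubmodule (Fin (n + 1)) K) := by
      rw [Finset.inf_eq_iInf]
      exact Ideal.IsHomogeneous.iInf₂ fun i _ => hA i
    filter_upwards [ih, eventually_ge_atTop N] with t ht htN
    rw [Finset.inf_insert, Finset.sum_insert hi, inf_comm, hilbertFunction_inf hS (hA i) hN htN,
      ht, add_comm]

end HilbertFunction

/-! ### Hilbert function of a power of the ideal of a flat -/

section FlatHilbertFunction

variable {K : Type*} [Field K] {n : ℕ}

/-- The exponents of total degree `t` whose degree in the first group of variables is less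
than `m`. -/
def standardExponents (α β : Type*) [Fintype α] [Fintype β] [DecidableEq α] [DecidableEq β]
    (m t : ℕ) : Finset (α ⊕ β →₀ ℕ) :=
  ((Finset.univ : Finset (α ⊕ β)).finsuppAntidiag t).filter fun d => inlDegree d < m

lemma mem_standardExponents {α β : Type*} [Fintype α] [Fintype β] [DecidableEq α] [DecidableEq β]
    {m t : ℕ} {d : α ⊕ β →₀ ℕ} :
    d ∈ standardExponents α β m t ↔ d.degree = t ∧ inlDegree d < m := by
  simp [standardExponents, Finsupp.degree_eq_sum]

lemma card_standardExponents (α β : Type*) [Fintype α] [Fintype β] [DecidableEq α]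
    [DecidableEq β] {m t : ℕ} (h : m ≤ t) :
    (standardExponents α β m t).card = ∑ j ∈ Finset.range m,
      (Fintype.card α).multichoose j * (Fintype.card β).multichoose (t - j) := by
  rw [Finset.card_eq_sum_card_fiberwise (f := inlDegree) (t := Finset.range m)
    fun d hd => by simpa using (mem_standardExponents.1 hd).2]
  -- Fix the degree `j` in the first group; the second group then has degree `t - j`, a true
  -- subtraction because `j < m ≤ t`.
  refine Finset.sum_congr rfl fun j hj => ?_
  rw [← Finset.card_univ, ← Finset.card_univ, ← Finset.card_finsuppAntidiag_nat_eq_multichoose,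
    ← Finset.card_finsuppAntidiag_nat_eq_multichoose, ← Finset.card_product]
  refine Finset.card_equiv Finsupp.sumFinsuppEquivProdFinsupp fun d => ?_
  rw [Finset.mem_range] at hj
  have hsum : ∑ i, d i = Finset.univ.sum ⇑(Finsupp.sumFinsuppEquivProdFinsupp d).1 +
      Finset.univ.sum ⇑(Finsupp.sumFinsuppEquivProdFinsupp d).2 := Fintype.sum_sum_type _
  have hinl : inlDegree d = Finset.univ.sum ⇑(Finsupp.sumFinsuppEquivProdFinsupp d).1 := rfl
  rw [Finset.mem_filter, mem_standardExponents, Finset.mem_product,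
    Finset.mem_finsuppAntidiag, Finset.mem_finsuppAntidiag, Finsupp.degree_eq_sum, hsum, hinl]
  simp only [Finset.subset_univ, and_true]
  omega

/-- In adapted coordinates, reading off the coefficients at the standard exponents is a surjection
from the forms of degree `t` with kernel the degree `t` part of the power. -/
lemma hilbertFunction_flatIdeal_pow [Infinite K] {c r : ℕ} (hc : c + r = n)
    {W : Submodule K (Fin (n + 1) → K)} (hW : Module.finrank K W = r + 1) {m t : ℕ} (h : m ≤ t) :
    hilbertFunction (flatIdeal W ^ m) t =
      ∑ j ∈ Finset.range m, c.multichoose j * (r + 1).multichoose (t - j) := by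
  obtain ⟨b, hb⟩ := exists_basis_adapted W hW hc
  set V := MvPolynomial.homogeneousSubmodule (Fin (n + 1)) K t with hV
  let T : V →ₗ[K] (standardExponents (Fin c) (Fin (r + 1)) m t → K) :=
    LinearMap.pi (fun d => MvPolynomial.lcoeff K d.1) ∘ₗ
      (basisAlgEquiv b).toLinearMap ∘ₗ V.subtype
  have hT : ∀ (f : V) d, T f d = MvPolynomial.coeff d.1 (basisAlgEquiv b f) := fun _ _ => rfl
  have hker : LinearMap.ker T = ((flatIdeal W ^ m).restrictScalars K).comap V.subtype := by
    ext f
    rw [LinearMap.mem_ker, Submodule.mem_comap, Submodule.restrictScalars_mem,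
      mem_flatIdeal_pow_iff hb, X_pow_dvd_inlScale_iff]
    constructor
    · intro h0 d hd
      by_contra! hlt
      have hdeg : d.degree = t := by
        rw [Finsupp.degree_eq_weight_one]
        exact isHomogeneous_basisAlgEquiv b f.2 (MvPolynomial.mem_support_iff.1 hd)
      have := congrFun h0 ⟨d, mem_standardExponents.2 ⟨hdeg, hlt⟩⟩
      exact (MvPolynomial.mem_support_iff.1 hd) this
    · intro h0
      ext d
      rw [hT]
      by_contra hne
      have := h0 d.1 (MvPolynomial.mem_support_iff.2 hne)
      have := (mem_standardExponents.1 d.2).2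
      omega
  have hsurj : Function.Surjective T := by
    intro g
    have hg : (∑ d, MvPolynomial.monomial d.1 (g d) :
        MvPolynomial (Fin c ⊕ Fin (r + 1)) K).IsHomogeneous t := by
      refine MvPolynomial.IsHomogeneous.sum _ _ _ fun d _ => ?_
      exact MvPolynomial.isHomogeneous_monomial _ (mem_standardExponents.1 d.2).1
    refine ⟨⟨(basisAlgEquiv b).symm _, isHomogeneous_basisAlgEquiv_symm b hg⟩, ?_⟩
    ext d
    rw [hT]
    simp only [AlgEquiv.apply_symm_apply]
    rw [MvPolynomial.coeff_sum, Finset.sum_eq_single d]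
    · simp
    · intro e _ hne
      rw [MvPolynomial.coeff_monomial, if_neg]
      exact fun h => hne (Subtype.ext h)
    · simp
  have hcard := card_standardExponents (Fin c) (Fin (r + 1)) h
  rw [Fintype.card_fin, Fintype.card_fin] at hcard
  rw [← hcard]
  change Module.finrank K (V ⧸ ((flatIdeal W ^ m).restrictScalars K).comap V.subtype) = _
  rw [← hker, (T.quotKerEquivOfSurjective hsurj).finrank_eq, Module.finrank_fintype_fun_eq_card,
    Fintype.card_coe]

end FlatHilbertFunction


/-! ### Binomial coefficients as polynomials -/

section BinomialPolynomial

/-- The polynomial `binom(t + k, k)` in the variable `t`. -/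
def binomialPolynomial (k : ℕ) : ℚ[X] :=
  C ((k ! : ℚ)⁻¹) * ∏ i ∈ Finset.range k, (X + C ((i : ℚ) + 1))

lemma eval_binomialPolynomial (k t : ℕ) :
    (binomialPolynomial k).eval (t : ℚ) = (k + 1).multichoose t := by
  have h : (∏ i ∈ Finset.range k, ((t : ℚ) + ((i : ℚ) + 1))) = k ! * (t + k).choose k := by
    have h1 := Nat.ascFactorial_eq_factorial_mul_choose t k
    rw [Nat.ascFactorial_eq_prod_range] at h1
    have h2 := congrArg (Nat.cast : ℕ → ℚ) h1
    push_cast at h2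
    rw [← h2]
    exact Finset.prod_congr rfl fun i _ => by ring
  rw [binomialPolynomial, Polynomial.eval_mul, Polynomial.eval_C, Polynomial.eval_prod]
  simp only [Polynomial.eval_add, Polynomial.eval_X, Polynomial.eval_C]
  rw [h, inv_mul_cancel_left₀ (by exact_mod_cast k.factorial_ne_zero), Nat.multichoose_eq,
    show k + 1 + t - 1 = t + k by omega, Nat.choose_symm_add]

lemma natDegree_binomialPolynomial (k : ℕ) : (binomialPolynomial k).natDegree = k := by
  rw [binomialPolynomial, Polynomial.natDegree_C_mul (inv_ne_zero (by positivity)),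
    Polynomial.natDegree_prod_of_monic _ _ fun i _ => Polynomial.monic_X_add_C _]
  simp only [Polynomial.natDegree_X_add_C, Finset.sum_const, Finset.card_range, smul_eq_mul,
    mul_one]

lemma coeff_binomialPolynomial (k : ℕ) : (binomialPolynomial k).coeff k = (k ! : ℚ)⁻¹ := by
  have h : (∏ i ∈ Finset.range k, (X + C ((i : ℚ) + 1)) : ℚ[X]).Monic :=
    Polynomial.monic_prod_of_monic _ _ fun i _ => Polynomial.monic_X_add_C _
  have hd : (∏ i ∈ Finset.range k, (X + C ((i : ℚ) + 1)) : ℚ[X]).natDegree = k := by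
    rw [Polynomial.natDegree_prod_of_monic _ _ fun i _ => Polynomial.monic_X_add_C _]
    simp only [Polynomial.natDegree_X_add_C, Finset.sum_const, Finset.card_range, smul_eq_mul,
      mul_one]
  rw [binomialPolynomial, Polynomial.coeff_C_mul]
  nth_rewrite 3 [← hd]
  rw [h.coeff_natDegree, mul_one]

end BinomialPolynomial

/-! ### Families of polynomials depending polynomially on a parameter -/

section PolynomialFamilies

/-- `g m` is a polynomial in `m` of degree at most `d` whose coefficients are polynomials of degree
at most `e`. -/
def IsPolynomialFamily (d e : ℕ) (g : ℕ → ℚ[X]) : Prop :=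
  ∃ G : ℚ[X][X], G.natDegree ≤ d ∧ (∀ k, (G.coeff k).natDegree ≤ e) ∧
    ∀ m : ℕ, G.eval (C (m : ℚ)) = g m

lemma IsPolynomialFamily.sum {ι : Type*} {d e : ℕ} (S : Finset ι) {g : ι → ℕ → ℚ[X]}
    (h : ∀ i ∈ S, IsPolynomialFamily d e (g i)) :
    IsPolynomialFamily d e fun m => ∑ i ∈ S, g i m := by
  choose! G h1 h2 h3 using h
  refine ⟨∑ i ∈ S, G i, Polynomial.natDegree_sum_le_of_forall_le _ _ h1, fun k => ?_, fun m => ?_⟩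
  · rw [Polynomial.finsetSum_coeff]
    exact Polynomial.natDegree_sum_le_of_forall_le _ _ fun i hi => h2 i hi k
  · rw [Polynomial.eval_finsetSum]
    exact Finset.sum_congr rfl fun i hi => h3 i hi m

lemma isPolynomialFamily_mul_C_eval {d e : ℕ} {p H : ℚ[X]} (hp : p.natDegree ≤ e)
    (hH : H.natDegree ≤ d) : IsPolynomialFamily d e fun m => p * C (H.eval (m : ℚ)) := by
  refine ⟨C p * H.map C, ?_, fun k => ?_, fun m => ?_⟩
  · exact (Polynomial.natDegree_C_mul_le _ _).trans (Polynomial.natDegree_map_le.trans hH)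
  · rw [Polynomial.coeff_C_mul, Polynomial.coeff_map]
    exact (Polynomial.natDegree_mul_C_le _ _).trans hp
  · rw [Polynomial.eval_mul, Polynomial.eval_C, Polynomial.eval_map, Polynomial.eval₂_at_apply]

lemma IsPolynomialFamily.mono {d e d' e' : ℕ} {g : ℕ → ℚ[X]} (h : IsPolynomialFamily d e g)
    (hd : d ≤ d') (he : e ≤ e') : IsPolynomialFamily d' e' g := by
  obtain ⟨G, h1, h2, h3⟩ := h
  exact ⟨G, h1.trans hd, fun k => (h2 k).trans he, h3⟩

lemma IsPolynomialFamily.congr {d e : ℕ} {g g' : ℕ → ℚ[X]} (h : IsPolynomialFamily d e g)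
    (hg : ∀ m, g m = g' m) : IsPolynomialFamily d e g' := by
  rwa [← funext hg]

lemma IsPolynomialFamily.C_mul {d e : ℕ} {g : ℕ → ℚ[X]} (h : IsPolynomialFamily d e g) (a : ℚ) :
    IsPolynomialFamily d e fun m => C a * g m := by
  obtain ⟨G, h1, h2, h3⟩ := h
  refine ⟨C (C a) * G, (Polynomial.natDegree_C_mul_le _ _).trans h1, fun k => ?_, fun m => ?_⟩
  · rw [Polynomial.coeff_C_mul]
    exact (Polynomial.natDegree_C_mul_le _ _).trans (h2 k)
  · rw [Polynomial.eval_mul, Polynomial.eval_C, h3]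

lemma exists_polynomial_sum_range_pow (q : ℕ) :
    ∃ S : ℚ[X], S.natDegree ≤ q + 1 ∧
      ∀ m : ℕ, S.eval (m : ℚ) = ∑ j ∈ Finset.range m, (j : ℚ) ^ q := by
  refine ⟨∑ i ∈ Finset.range (q + 1),
    C (_root_.bernoulli i * ((q + 1).choose i : ℚ) / (q + 1)) * X ^ (q + 1 - i), ?_, fun m => ?_⟩
  · exact Polynomial.natDegree_sum_le_of_forall_le _ _ fun i _ =>
      (Polynomial.natDegree_C_mul_X_pow_le _ _).trans (Nat.sub_le _ _)
  · rw [sum_range_pow, Polynomial.eval_finsetSum]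
    refine Finset.sum_congr rfl fun i _ => ?_
    rw [Polynomial.eval_mul, Polynomial.eval_C, Polynomial.eval_pow, Polynomial.eval_X]
    ring

/-- In the binomial expansion, the term with `X ^ a` carries `m ^ a` times the power sum of exponent
`i + k - a`, of degree at most `i + k - a + 1` in `m`; the total is `i + k + 1` for every `a`. -/
lemma isPolynomialFamily_sum_pow (i k : ℕ) :
    IsPolynomialFamily (i + k + 1) k fun m =>
      ∑ j ∈ Finset.range m, C ((j : ℚ) ^ i) * (C (m : ℚ) * X - C (j : ℚ)) ^ k := by
  have h : ∀ a ∈ Finset.range (k + 1), IsPolynomialFamily (i + k + 1) k fun m =>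
      C ((-1) ^ (k - a) * (k.choose a : ℚ)) * (X ^ a *
        C ((m : ℚ) ^ a * ∑ j ∈ Finset.range m, (j : ℚ) ^ (i + (k - a)))) := by
    intro a ha
    have ha' : a ≤ k := Nat.lt_succ_iff.1 (Finset.mem_range.1 ha)
    obtain ⟨S, hS, hSe⟩ := exists_polynomial_sum_range_pow (i + (k - a))
    have := isPolynomialFamily_mul_C_eval (p := X ^ a) (H := X ^ a * S) (d := i + k + 1) (e := k)
      ((Polynomial.natDegree_X_pow_le a).trans ha')
      ((Polynomial.natDegree_mul_le).trans
        ((Nat.add_le_add (Polynomial.natDegree_X_pow_le a) hS).trans (by omega)))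
    simp only [Polynomial.eval_mul, Polynomial.eval_pow, Polynomial.eval_X, hSe] at this
    exact this.C_mul _
  convert IsPolynomialFamily.sum _ h using 2 with m
  simp only [sub_eq_add_neg, add_pow, Finset.mul_sum, map_sum, map_mul]
  rw [Finset.sum_comm]
  refine Finset.sum_congr rfl fun a _ => Finset.sum_congr rfl fun j _ => ?_
  rw [mul_pow, neg_pow]
  simp only [map_mul, map_pow, map_neg, map_one, pow_add, map_natCast]
  ring

lemma isPolynomialFamily_sum_comp {p q : ℚ[X]} {d e : ℕ} (hp : p.natDegree ≤ d)
    (hq : q.natDegree ≤ e) :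
    IsPolynomialFamily (d + e + 1) e fun m =>
      ∑ j ∈ Finset.range m, C (p.eval (j : ℚ)) * q.comp (C (m : ℚ) * X - C (j : ℚ)) := by
  have h : ∀ i ∈ Finset.range (d + 1), IsPolynomialFamily (d + e + 1) e fun m =>
      ∑ k ∈ Finset.range (e + 1), C (p.coeff i * q.coeff k) *
        ∑ j ∈ Finset.range m, C ((j : ℚ) ^ i) * (C (m : ℚ) * X - C (j : ℚ)) ^ k := by
    intro i hi
    refine IsPolynomialFamily.sum _ fun k hk => ?_
    rw [Finset.mem_range] at hi hk
    exact ((isPolynomialFamily_sum_pow i k).C_mul _).mono (by omega) (by omega)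
  convert IsPolynomialFamily.sum _ h using 2 with m
  simp only [Finset.mul_sum]
  rw [Finset.sum_congr rfl fun i _ => Finset.sum_comm, Finset.sum_comm]
  refine Finset.sum_congr rfl fun j _ => ?_
  rw [Polynomial.eval_eq_sum_range' (Nat.lt_succ_iff.2 hp), Polynomial.comp,
    Polynomial.eval₂_eq_sum_range' _ (Nat.lt_succ_iff.2 hq), map_sum, Finset.sum_mul_sum]
  refine Finset.sum_congr rfl fun i _ => Finset.sum_congr rfl fun k _ => ?_
  simp only [map_mul]
  ring

lemma tendsto_eval_div_pow {p : ℝ[X]} {n : ℕ} (hp : p.natDegree ≤ n) :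
    Tendsto (fun m : ℕ => p.eval (m : ℝ) / (m : ℝ) ^ n) atTop (𝓝 (p.coeff n)) := by
  have h : ∀ k ∈ Finset.range (n + 1), Tendsto (fun m : ℕ => p.coeff k * (m : ℝ) ^ k / (m : ℝ) ^ n)
      atTop (𝓝 (if k = n then p.coeff n else 0)) := by
    intro k hk
    split_ifs with hkn
    · subst hkn
      refine tendsto_const_nhds.congr' ?_
      filter_upwards [eventually_gt_atTop 0] with m hm
      have : (m : ℝ) ^ k ≠ 0 := by positivity
      field_simp
    · have hlt : k < n := by
        rw [Finset.mem_range] at hk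
        omega
      have h1 := ((tendsto_pow_div_pow_atTop_zero (𝕜 := ℝ) hlt).comp
        tendsto_natCast_atTop_atTop).const_mul (p.coeff k)
      rw [mul_zero] at h1
      exact h1.congr fun m => by simp [mul_div_assoc]
  have h2 := tendsto_finsetSum _ h
  rw [Finset.sum_ite_eq' (Finset.range (n + 1)) n, if_pos (Finset.self_mem_range_succ n)] at h2
  refine h2.congr fun m => ?_
  rw [Polynomial.eval_eq_sum_range' (Nat.lt_succ_iff.2 hp), Finset.sum_div]

/-- The polynomial `binom(y t + n, n)` in the variable `y` with coefficients polynomials in `t`. -/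
def scaledBinomialPolynomial (n : ℕ) : ℚ[X][X] :=
  ∑ k ∈ Finset.range (n + 1), C (C ((binomialPolynomial n).coeff k) * X ^ k) * X ^ k

lemma natDegree_scaledBinomialPolynomial_le (n : ℕ) :
    (scaledBinomialPolynomial n).natDegree ≤ n :=
  Polynomial.natDegree_sum_le_of_forall_le _ _ fun _ hk =>
    (Polynomial.natDegree_C_mul_X_pow_le _ _).trans (Nat.lt_succ_iff.1 (Finset.mem_range.1 hk))

lemma coeff_scaledBinomialPolynomial (n : ℕ) :
    (scaledBinomialPolynomial n).coeff n = C ((n ! : ℚ)⁻¹) * X ^ n := by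
  rw [scaledBinomialPolynomial, Polynomial.finsetSum_coeff]
  simp only [Polynomial.coeff_C_mul, Polynomial.coeff_X_pow, mul_ite, mul_one, mul_zero]
  rw [Finset.sum_ite_eq (Finset.range (n + 1)) n, if_pos (Finset.self_mem_range_succ n),
    coeff_binomialPolynomial]

lemma eval_scaledBinomialPolynomial (n : ℕ) (a : ℚ) :
    (scaledBinomialPolynomial n).eval (C a) = (binomialPolynomial n).comp (C a * X) := by
  rw [scaledBinomialPolynomial, Polynomial.eval_finsetSum, Polynomial.comp,
    Polynomial.eval₂_eq_sum_range, natDegree_binomialPolynomial]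
  refine Finset.sum_congr rfl fun k _ => ?_
  rw [Polynomial.eval_mul, Polynomial.eval_C, Polynomial.eval_pow, Polynomial.eval_X, mul_pow]
  ring

end PolynomialFamilies


/-! ### Uniqueness of the polynomials, and the limit -/

section HilbertPolynomial

variable {K : Type*} [Field K] {n : ℕ}

lemma IsHilbertPolynomial.hilbertPolynomial_eq {I : Ideal (MvPolynomial (Fin (n + 1)) K)}
    {P : ℚ[X]} (hP : IsHilbertPolynomial I P) : hilbertPolynomial I = P := by
  have hex : ∃ P : ℚ[X], IsHilbertPolynomial I P := ⟨P, hP⟩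
  rw [hilbertPolynomial, dif_pos hex]
  obtain ⟨N, hN⟩ := eventually_atTop.1 (hP.and hex.choose_spec)
  refine Polynomial.eq_of_infinite_eval_eq _ _
    (((Set.Ici_infinite N).image (Nat.cast_injective (R := ℚ)).injOn).mono ?_)
  rintro _ ⟨t, ht, rfl⟩
  exact (hN t ht).2.symm.trans (hN t ht).1

lemma leadingDefect_eq {I : Ideal (MvPolynomial (Fin (n + 1)) K)} {Q : ℚ[X][X]}
    (hQ : IsDefectPolynomial I Q) : leadingDefect I = Q.leadingCoeff := by
  have hex : ∃ Q : ℚ[X][X], IsDefectPolynomial I Q := ⟨Q, hQ⟩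
  rw [leadingDefect, dif_pos hex]
  congr 1
  refine Polynomial.eq_of_infinite_eval_eq _ _
    (((Set.Ici_infinite 1).image ((Polynomial.C_injective (R := ℚ)).comp
      (Nat.cast_injective (R := ℚ))).injOn).mono ?_)
  rintro _ ⟨m, hm, rfl⟩
  exact (hex.choose_spec m hm).trans (hQ m hm).symm

lemma aeval_mul_eq_eval_map {P : ℚ[X]} {H : ℚ[X][X]} {m : ℕ} (t : ℝ)
    (h : P.comp (C (m : ℚ) * X) = H.eval (C (m : ℚ))) :
    aeval ((m : ℝ) * t) P = (H.map (aeval t).toRingHom).eval (m : ℝ) := by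
  have h1 := congrArg (aeval t) h
  rw [Polynomial.aeval_comp] at h1
  simp only [map_mul, Polynomial.aeval_C, Polynomial.aeval_X, eq_ratCast, Rat.cast_natCast] at h1
  rw [h1, Polynomial.eval_map]
  have h2 := Polynomial.hom_eval₂ H (RingHom.id _) (aeval t : ℚ[X] →ₐ[ℚ] ℝ).toRingHom
    (C (m : ℚ))
  rw [RingHom.comp_id] at h2
  have h3 : (aeval t : ℚ[X] →ₐ[ℚ] ℝ).toRingHom (C (m : ℚ)) = m :=
    (Polynomial.aeval_C t (m : ℚ)).trans (by simp)
  rw [h3] at h2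
  exact h2

lemma tendsto_aeval_hilbertPolynomial {I : Ideal (MvPolynomial (Fin (n + 1)) K)} {H : ℚ[X][X]}
    (hH : H.natDegree ≤ n)
    (h : ∀ m : ℕ, 1 ≤ m →
      (hilbertPolynomial (symbolicPower I m)).comp (C (m : ℚ) * X) = H.eval (C (m : ℚ))) (t : ℝ) :
    Tendsto (fun m : ℕ =>
      aeval ((m : ℝ) * t) (hilbertPolynomial (symbolicPower I m)) / (m : ℝ) ^ n) atTop
      (𝓝 (aeval t (H.coeff n))) := by
  have h1 := tendsto_eval_div_pow (p := H.map (aeval t : ℚ[X] →ₐ[ℚ] ℝ).toRingHom)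
    (Polynomial.natDegree_map_le.trans hH)
  rw [Polynomial.coeff_map] at h1
  refine h1.congr' ?_
  filter_upwards [eventually_ge_atTop 1] with m hm
  rw [aeval_mul_eq_eval_map t (h m hm)]

lemma isDefectPolynomial_sub {I : Ideal (MvPolynomial (Fin (n + 1)) K)} {H : ℚ[X][X]}
    (h : ∀ m : ℕ, 1 ≤ m →
      (hilbertPolynomial (symbolicPower I m)).comp (C (m : ℚ) * X) = H.eval (C (m : ℚ))) :
    IsDefectPolynomial I (scaledBinomialPolynomial n - H) := by
  intro m hm
  rw [hilbertDefect, Polynomial.sub_comp, h m hm, Polynomial.eval_sub,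
    eval_scaledBinomialPolynomial, binomialPolynomial]

end HilbertPolynomial

/-! ### The explicit Hilbert polynomial of disjoint flats -/

section DisjointFlats

variable {K : Type*} [Field K] {n r s : ℕ}
  {L : Fin s → Projectivization.Subspace K (Fin (n + 1) → K)}

lemma IsDisjointFlats.ne_bot (hL : IsDisjointFlats r s L) (i : Fin s) :
    (L i).submodule ≠ ⊥ := by
  intro h
  have := hL.finrank_eq i
  rw [h, finrank_bot] at this
  omega

lemma IsDisjointFlats.disjoint_submodule (hL : IsDisjointFlats r s L) :
    Pairwise fun i j => Disjoint (L i).submodule (L j).submodule := by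
  intro i j hij
  rw [Submodule.disjoint_def]
  intro v hi hj
  by_contra hv
  exact Set.disjoint_left.1 (hL.disjoint hij)
    ((Projectivization.Subspace.mem_submodule_iff _ hv).1 hi)
    ((Projectivization.Subspace.mem_submodule_iff _ hv).1 hj)

lemma IsDisjointFlats.le_of_pos (hL : IsDisjointFlats r s L) (hs : 0 < s) : r ≤ n := by
  have h := Submodule.finrank_le (L ⟨0, hs⟩).submodule
  rw [hL.finrank_eq, Module.finrank_fin_fun] at h
  omega

lemma IsDisjointFlats.le_one (hL : IsDisjointFlats n s L) : s ≤ 1 := by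
  by_contra! hs
  have htop : ∀ i, (L i).submodule = ⊤ := fun i =>
    Submodule.eq_top_of_finrank_eq (by rw [hL.finrank_eq, Module.finrank_fin_fun])
  have h := hL.disjoint_submodule (i := ⟨0, by omega⟩) (j := ⟨1, hs⟩) (by simp)
  simp only [htop, disjoint_top] at h
  exact top_ne_bot h

attribute [local instance] MvPolynomial.gradedAlgebra

lemma IsDisjointFlats.eventually_hilbertFunction [Infinite K] (hL : IsDisjointFlats r s L) (m : ℕ) :
    ∀ᶠ t in atTop, hilbertFunction (symbolicPower (idealOfFlats L) m) t =
      s * ∑ j ∈ Finset.range m, (n - r).multichoose j * (r + 1).multichoose (t - j) := by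
  -- An index is needed here: without flats `r` may exceed `n`, and then `n - r` is truncated but
  -- multiplied by `s = 0`.
  have hc : ∀ i : Fin s, n - r + r = n := fun i =>
    Nat.sub_add_cancel (hL.le_of_pos i.pos)
  have hsym : symbolicPower (idealOfFlats L) m =
      Finset.univ.inf fun i => flatIdeal (L i).submodule ^ m := by
    rw [idealOfFlats_eq_iInf L hL.ne_bot, Finset.inf_univ_eq_iInf]
    refine symbolicPower_iInf (fun i => flatIdeal_isPrime (hc i) (hL.finrank_eq i)) ?_
      fun i u f => mem_flatIdeal_pow_of_mul_mem (hc i) (hL.finrank_eq i)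
    intro i j hij hle
    rw [flatIdeal_le_iff] at hle
    exact hL.ne_bot j ((hL.disjoint_submodule hij).eq_bot_of_ge hle)
  have hev := eventually_hilbertFunction_inf (fun i => flatIdeal (L i).submodule ^ m)
    (fun i => (flatIdeal_isHomogeneous _).pow_of_homogeneous m)
    -- The exponent `m + m` suffices: in a product of `2m` factors from the two ideals, at least `m`
    -- come from the same one.
    (fun i j hij => ⟨m + m, (Ideal.pow_right_mono
      (irrelevantIdeal_le_sup (hL.disjoint_submodule hij)) _).trans
        Ideal.sup_pow_add_le_pow_sup_pow⟩) Finset.univ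
  filter_upwards [hev, eventually_ge_atTop m] with t ht htm
  rw [hsym, ht, Finset.sum_congr rfl fun i _ =>
    hilbertFunction_flatIdeal_pow (hc i) (hL.finrank_eq i) htm]
  simp

/-- The Hilbert polynomial of the `m`-th symbolic power of the ideal of `s` disjoint flats of
dimension `r` and codimension `c`. -/
def flatsHilbertPolynomial (c r s m : ℕ) : ℚ[X] :=
  C (s : ℚ) * ∑ j ∈ Finset.range m,
    C (c.multichoose j : ℚ) * (binomialPolynomial r).comp (X - C (j : ℚ))

lemma IsDisjointFlats.isHilbertPolynomial [Infinite K] (hL : IsDisjointFlats r s L) (m : ℕ) :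
    IsHilbertPolynomial (symbolicPower (idealOfFlats L) m)
      (flatsHilbertPolynomial (n - r) r s m) := by
  filter_upwards [hL.eventually_hilbertFunction m, eventually_ge_atTop m] with t ht htm
  rw [ht, flatsHilbertPolynomial, Polynomial.eval_mul, Polynomial.eval_C,
    Polynomial.eval_finsetSum]
  push_cast
  congr 1
  refine Finset.sum_congr rfl fun j hj => ?_
  have hjt : j ≤ t := (Finset.mem_range.1 hj).le.trans htm
  rw [Polynomial.eval_mul, Polynomial.eval_C, Polynomial.eval_comp, Polynomial.eval_sub,
    Polynomial.eval_X, Polynomial.eval_C, ← Nat.cast_sub hjt, eval_binomialPolynomial]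

end DisjointFlats

/-! ### Dependence on `m` and the leading coefficient -/

section FlatsFamily

lemma isPolynomialFamily_flatsHilbertPolynomial {c : ℕ} (hc : 0 < c) (r s : ℕ) :
    IsPolynomialFamily (c + r) r fun m => (flatsHilbertPolynomial c r s m).comp (C (m : ℚ) * X) := by
  -- For positive codimension `c + 1`, the weight of `j` is the value of a polynomial of degree `c`;
  -- summation over `j` then gives degree `c + r + 1` in `m`.
  obtain ⟨c, rfl⟩ := Nat.exists_eq_succ_of_ne_zero hc.ne'
  have h := (isPolynomialFamily_sum_comp (natDegree_binomialPolynomial c).le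
    (natDegree_binomialPolynomial r).le).C_mul s
  refine (h.mono (by omega) le_rfl).congr fun m => ?_
  rw [flatsHilbertPolynomial, Polynomial.mul_comp, Polynomial.C_comp,
    ← Polynomial.coe_compRingHom_apply (∑ j ∈ Finset.range m, _), map_sum]
  simp only [Polynomial.coe_compRingHom_apply, Polynomial.mul_comp, Polynomial.C_comp,
    Polynomial.comp_assoc, Polynomial.sub_comp, Polynomial.X_comp, eval_binomialPolynomial,
    Nat.succ_eq_add_one]

lemma flatsHilbertPolynomial_zero (r s : ℕ) {m : ℕ} (hm : 1 ≤ m) :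
    flatsHilbertPolynomial 0 r s m = C (s : ℚ) * binomialPolynomial r := by
  rw [flatsHilbertPolynomial, Finset.sum_eq_single_of_mem 0 (Finset.mem_range.2 hm)]
  · simp
  · intro j _ hj
    obtain ⟨j, rfl⟩ := Nat.exists_eq_succ_of_ne_zero hj
    simp

lemma leadingCoeff_eq_coeff_of_coeff_ne_zero {R : Type*} [Semiring R] {p : R[X]} {n : ℕ}
    (hp : p.natDegree ≤ n) (h : p.coeff n ≠ 0) : p.leadingCoeff = p.coeff n := by
  rw [Polynomial.leadingCoeff, le_antisymm hp (Polynomial.le_natDegree_of_ne_zero h)]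

/-- The term `t^n / n!` cannot be cancelled by a coefficient of degree less than `n` in `t`. -/
lemma leadingCoeff_scaledBinomialPolynomial_sub {n e : ℕ} (he : e < n) {H : ℚ[X][X]}
    (hH : H.natDegree ≤ n) (hHe : (H.coeff n).natDegree ≤ e) :
    (scaledBinomialPolynomial n - H).leadingCoeff = (scaledBinomialPolynomial n - H).coeff n := by
  refine leadingCoeff_eq_coeff_of_coeff_ne_zero
    ((Polynomial.natDegree_sub_le_of_le (natDegree_scaledBinomialPolynomial_le n) hH).trans
      (max_self n).le) fun h => ?_
  have h1 := congrArg (fun p => Polynomial.coeff p n) h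
  simp only [Polynomial.coeff_sub, coeff_scaledBinomialPolynomial, Polynomial.coeff_C_mul,
    Polynomial.coeff_X_pow_self, Polynomial.coeff_eq_zero_of_natDegree_lt (hHe.trans_lt he),
    Polynomial.coeff_zero, mul_one, sub_zero] at h1
  exact inv_ne_zero (by positivity) h1

lemma exists_flatsHilbertPolynomial_family {n r s : ℕ} (hrs : s = 0 ∨ r < n ∨ r = n ∧ s = 1) :
    ∃ H : ℚ[X][X], H.natDegree ≤ n ∧
      (∀ m : ℕ, 1 ≤ m →
        (flatsHilbertPolynomial (n - r) r s m).comp (C (m : ℚ) * X) = H.eval (C (m : ℚ))) ∧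
      (scaledBinomialPolynomial n - H).leadingCoeff =
        (scaledBinomialPolynomial n - H).coeff n := by
  rcases hrs with rfl | hr | ⟨rfl, rfl⟩
  · refine ⟨0, by simp, fun m _ => by simp [flatsHilbertPolynomial], ?_⟩
    rw [sub_zero]
    refine leadingCoeff_eq_coeff_of_coeff_ne_zero (natDegree_scaledBinomialPolynomial_le n) ?_
    rw [coeff_scaledBinomialPolynomial]
    exact mul_ne_zero (Polynomial.C_ne_zero.2 (inv_ne_zero (by positivity)))
      (pow_ne_zero _ Polynomial.X_ne_zero)
  · obtain ⟨H, h1, h2, h3⟩ := isPolynomialFamily_flatsHilbertPolynomial (Nat.sub_pos_of_lt hr) r s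
    rw [Nat.sub_add_cancel hr.le] at h1
    exact ⟨H, h1, fun m _ => (h3 m).symm, leadingCoeff_scaledBinomialPolynomial_sub hr h1 (h2 n)⟩
  -- The single flat is all of projective space, so the defect is zero and its leading coefficient
  -- is `0` by convention, again the coefficient of `m^n`.
  · refine ⟨scaledBinomialPolynomial r, natDegree_scaledBinomialPolynomial_le r, fun m hm => ?_,
      by simp⟩
    rw [Nat.sub_self, flatsHilbertPolynomial_zero r 1 hm, eval_scaledBinomialPolynomial]
    simp

end FlatsFamily

theorem mainTheorem6 {K : Type*} [Field K] [IsAlgClosed K] [CharZero K] (n r s : ℕ)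
    (L : Fin s → Projectivization.Subspace K (Fin (n + 1) → K)) (hL : IsDisjointFlats r s L) :
    -- every Hilbert polynomial involved exists
    (∀ m : ℕ, 1 ≤ m →
      IsHilbertPolynomial (symbolicPower (idealOfFlats L) m)
        (hilbertPolynomial (symbolicPower (idealOfFlats L) m))) ∧
    -- `binom(mt+n, n) - HP_{I^(m)}(mt)` is a polynomial in `m`, with leading coefficient `Λ(t)`
    (∃ Q : ℚ[X][X], IsDefectPolynomial (idealOfFlats L) Q ∧
      Q.leadingCoeff = leadingDefect (idealOfFlats L)) ∧
    -- `Λ` depends only on `n`, `r` and `s`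
    (∀ L' : Fin s → Projectivization.Subspace K (Fin (n + 1) → K), IsDisjointFlats r s L' →
      leadingDefect (idealOfFlats L') = leadingDefect (idealOfFlats L)) ∧
    -- the limit defining `aHP_I(t)` exists, and its value is `t ^ n / n! - Λ(t)`
    (∀ t : ℝ,
      Tendsto (fun m : ℕ =>
          aeval ((m : ℝ) * t) (hilbertPolynomial (symbolicPower (idealOfFlats L) m)) / (m : ℝ) ^ n)
        atTop (𝓝 (asymptoticHilbertPolynomial (idealOfFlats L) t)) ∧
      asymptoticHilbertPolynomial (idealOfFlats L) t =
        t ^ n / (n ! : ℝ) - aeval t (leadingDefect (idealOfFlats L))) := by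
  have hHP : ∀ L' : Fin s → Projectivization.Subspace K (Fin (n + 1) → K),
      IsDisjointFlats r s L' → ∀ m, hilbertPolynomial (symbolicPower (idealOfFlats L') m) =
        flatsHilbertPolynomial (n - r) r s m :=
    fun L' hL' m => (hL'.isHilbertPolynomial m).hilbertPolynomial_eq
  have hrs : s = 0 ∨ r < n ∨ r = n ∧ s = 1 := by
    rcases Nat.eq_zero_or_pos s with hs | hs
    · exact Or.inl hs
    · rcases (hL.le_of_pos hs).lt_or_eq with h | rfl
      · exact Or.inr (Or.inl h)
      · exact Or.inr (Or.inr ⟨rfl, le_antisymm hL.le_one hs⟩)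
  obtain ⟨H, hH1, hH2, hH3⟩ := exists_flatsHilbertPolynomial_family hrs
  have hdefect : ∀ L' : Fin s → Projectivization.Subspace K (Fin (n + 1) → K),
      IsDisjointFlats r s L' →
        IsDefectPolynomial (idealOfFlats L') (scaledBinomialPolynomial n - H) :=
    fun L' hL' => isDefectPolynomial_sub fun m hm => by rw [hHP L' hL' m, hH2 m hm]
  refine ⟨fun m _ => ?_, ⟨_, hdefect L hL, (leadingDefect_eq (hdefect L hL)).symm⟩,
    fun L' hL' => ?_, fun t => ?_⟩
  · rw [hHP L hL m]
    exact hL.isHilbertPolynomial m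
  · rw [leadingDefect_eq (hdefect L' hL'), leadingDefect_eq (hdefect L hL)]
  · have hlim := tendsto_aeval_hilbertPolynomial (I := idealOfFlats L) hH1
      (fun m hm => by rw [hHP L hL m, hH2 m hm]) t
    have hval : asymptoticHilbertPolynomial (idealOfFlats L) t = aeval t (H.coeff n) :=
      hlim.limUnder_eq
    refine ⟨hval ▸ hlim, ?_⟩
    rw [hval, leadingDefect_eq (hdefect L hL), hH3, Polynomial.coeff_sub,
      coeff_scaledBinomialPolynomial]
    simp [div_eq_inv_mul]

end
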